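/- Let $p>2$ be a prime and let $n\ge m\ge 2$ be integers. Write $[x,y]=x^{-1}y^{-1}xy$, $G_3=[[G,G],G]$, let $\Phi(G')$ be the Frattini subgroup of the derived subgroup $G'$ of $G$, and let $$M_p(n,m,1)=\langle a,b,c \mid a^{p^n}=b^{p^m}=c^p=1,\ [a,b]=c,\ [c,a]=[c,b]=1\rangle .$$ Let $G$ and $\bar G$ be finite $p$-groups such that $G_3\le \Phi(G')\cong C_p$ and $G/\Phi(G')\cong M_p(n,m,1)$, and likewise $\bar G_3\le \Phi(\bar G')\cong C_p$ and $\bar G/\Phi(\bar G')\cong M_p(n,m,1)$. A matrix $w=(w_{ij})\in M_2(\mathbb F_p)$ is called a characteristic matrix of $G$ if there are $a,b\in G$ such that some isomorphism $G/\Phi(G')\cong M_p(n,m,1)$ carries the images of $a,b$ to the generators $a,b$ of $M_p(n,m,1)$ and such that, with $c=[a,b]$, $$a^{p^n}=c^{w_{11}p},\qquad b^{p^m}=c^{w_{21}p},\qquad [c,a]=c^{w_{12}p},\qquad [c,b]=c^{w_{22}p}$$ (here $c$ has order $p^2$, so the exponents make sense). Let $w=(w_{ij})$ be a characteristic matrix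 of $G$ and $\bar w=(\bar w_{ij})$ a characteristic matrix of $\bar G$. Then $G\cong\bar G$ if and only if there exist $x_{11},x_{12},x_{21},x_{22}\in\mathbb F_p$ such that the matrix $$X=\begin{pmatrix}x_{11}&x_{12}\\ x_{21}p^{n-m}&x_{22}\end{pmatrix}$$ over $\mathbb F_p$ is invertible and $$\begin{pmatrix}\bar w_{11}\\ \bar w_{21}\end{pmatrix}=|X|^{-1}\begin{pmatrix}x_{11}&x_{12}p^{n-m}\\ x_{21}&x_{22}\end{pmatrix}\begin{pmatrix}w_{11}\\ w_{21}\end{pmatrix},\qquad \begin{pmatrix}\bar w_{12}\\ \bar w_{22}\end{pmatrix}=X\begin{pmatrix}w_{12}\\ w_{22}\end{pmatrix},$$ where $|X|$ is the determinant of $X$ and $p^{n-m}$ is read in $\mathbb F_p$ (so it is $1$ if $n=m$ and $0$ if $n>m$). -/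

import Mathlib

/-- The commutator of two elements in the usual convention of `p`-group theory,
`[x, y] = x⁻¹ y⁻¹ x y`. -/
def pcomm {G : Type*} [Group G] (x y : G) : G := x⁻¹ * y⁻¹ * x * y

/-- The subgroup `Φ(G')` of `G`: the Frattini subgroup of the derived subgroup `G'`. -/
def derivedFrattini (G : Type*) [Group G] : Subgroup G :=
  (frattini (commutator G)).map (commutator G).subtype

instance derivedFrattini_normal (G : Type*) [Group G] : (derivedFrattini G).Normal :=
  ConjAct.normal_of_characteristic_of_normal

/-- The three generator symbols `a, b, c`. -/
inductive MpGen : Type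
  | a
  | b
  | c

/-- The relators of `M_p(n, m, 1)`, expressing
`a ^ p ^ n = b ^ p ^ m = c ^ p = 1`, `[a, b] = c`, `[c, a] = [c, b] = 1`. -/
def MpRels (p n m : ℕ) : Set (FreeGroup MpGen) :=
  {FreeGroup.of MpGen.a ^ p ^ n,
   FreeGroup.of MpGen.b ^ p ^ m,
   FreeGroup.of MpGen.c ^ p,
   pcomm (FreeGroup.of MpGen.a) (FreeGroup.of MpGen.b) * (FreeGroup.of MpGen.c)⁻¹,
   pcomm (FreeGroup.of MpGen.c) (FreeGroup.of MpGen.a),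
   pcomm (FreeGroup.of MpGen.c) (FreeGroup.of MpGen.b)}

/-- The group
`M_p(n, m, 1) = ⟨a, b, c ∣ a ^ p ^ n = b ^ p ^ m = c ^ p = 1, [a, b] = c, [c, a] = [c, b] = 1⟩`. -/
abbrev Mp (p n m : ℕ) : Type := PresentedGroup (MpRels p n m)

/-- `a, b` are characteristic generators of `G`: their images in `G / Φ(G')` are the first two
standard generators in a presentation of `G / Φ(G')` as `M_p(n, m, 1)`, that is, some isomorphism
`G / Φ(G') ≅ M_p(n, m, 1)` sends these images to the generators `a` and `b`. -/
def IsCharGenerators (p n m : ℕ) {G : Type*} [Group G] (a b : G) : Prop :=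
  ∃ φ : (G ⧸ derivedFrattini G) ≃* Mp p n m,
    φ (QuotientGroup.mk a) = PresentedGroup.of MpGen.a ∧
    φ (QuotientGroup.mk b) = PresentedGroup.of MpGen.b

/-- `w` is a characteristic matrix of `G` (with respect to some characteristic generators `a, b`):
with `c = [a, b]`, one has `a ^ p ^ n = c ^ (w₁₁ p)`, `b ^ p ^ m = c ^ (w₂₁ p)`,
`[c, a] = c ^ (w₁₂ p)` and `[c, b] = c ^ (w₂₂ p)`.
Rows and columns are indexed from `0`; an entry is read through its representative in
`{0, …, p - 1}`. -/
def IsCharMatrix (p n m : ℕ) (G : Type*) [Group G] (w : Matrix (Fin 2) (Fin 2) (ZMod p)) : Prop :=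
  ∃ a b : G, IsCharGenerators p n m a b ∧
    a ^ p ^ n = pcomm a b ^ ((w 0 0).val * p) ∧
    b ^ p ^ m = pcomm a b ^ ((w 1 0).val * p) ∧
    pcomm (pcomm a b) a = pcomm a b ^ ((w 0 1).val * p) ∧
    pcomm (pcomm a b) b = pcomm a b ^ ((w 1 1).val * p)

/-- The standing hypotheses on `G`: a finite `p`-group with `G₃ ≤ Φ(G') ≅ C_p` and
`G / Φ(G') ≅ M_p(n, m, 1)`, where `G₃ = [[G, G], G]` is the third term of the lower central
series (Mathlib numbers that series from `0`). -/
structure InClass (p n m : ℕ) (G : Type*) [Group G] : Prop where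
  finite : Finite G
  isPGroup : IsPGroup p G
  third_le : (⊤ : Subgroup G).lowerCentralSeries 2 ≤ derivedFrattini G
  frattini_equiv : Nonempty (derivedFrattini G ≃* Multiplicative (ZMod p))
  quotient_equiv : Nonempty ((G ⧸ derivedFrattini G) ≃* Mp p n m)

/-! The matrix determines the group. Put c = [a, b]; then G' = ⟨c⟩ has order p², c ^ p is central,
and |G| ≥ p^(n+m+2), because G maps onto ℤ/pⁿ × ℤ/pᵐ with G' in the kernel (`CharData.card_le`).
Conversely, a finite group generated by a pair satisfying the relations of a given matrix, with c ^
p central of order dividing p, has order at most p^(n+m+2). Hence groups with the same matrix are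
isomorphic (`IsMaximalPair.nonempty_mulEquiv`), and G ≅ H exactly when G has a generating pair with
the matrix of H.

Such pairs have the form A = a^i b^j g, B = a^(s p^(n-m)) b^t g' with g, g' ∈ G'
(`CharData.exists_change_of_generators`). With D the determinant of the exponents, [A, B] is c^D
modulo ⟨c ^ p⟩. Since p is odd, the p^N-th power map is multiplicative for N ≥ 2
(`CharData.mul_pow_prime_pow`), so the power relations are linear in the first column of w; the
commutator relations are linear in the second column, with a factor D on both sides. Comparing
exponents of c ^ p (`CharData.relations_iff`) and cancelling D gives the two matrix equations. -/

/-! ### Commutator identities and the collection formula -/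

section Commutator

variable {G : Type*} [Group G]

open scoped commutatorElement in
theorem pcomm_eq_commutatorElement (x y : G) : pcomm x y = ⁅x⁻¹, y⁻¹⁆ := by
  simp [pcomm, commutatorElement_def]

theorem pcomm_self (x : G) : pcomm x x = 1 := by
  simp [pcomm]

theorem pcomm_inv (x y : G) : (pcomm x y)⁻¹ = pcomm y x := by
  simp [pcomm, mul_assoc]

theorem map_pcomm {H : Type*} [Group H] (f : G →* H) (x y : G) :
    f (pcomm x y) = pcomm (f x) (f y) := by
  simp [pcomm]

theorem mul_mul_pcomm (x y : G) : y * x * pcomm x y = x * y := by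
  simp [pcomm, mul_assoc]

theorem pcomm_mem_commutator (x y : G) : pcomm x y ∈ commutator G := by
  rw [pcomm_eq_commutatorElement]
  exact Subgroup.commutator_mem_commutator (Subgroup.mem_top _) (Subgroup.mem_top _)

theorem pcomm_eq_one_of_mem_center_left {x : G} (hx : x ∈ Subgroup.center G) (y : G) :
    pcomm x y = 1 := by
  have h := Subgroup.mem_center_iff.1 hx y
  rw [pcomm, mul_assoc, mul_assoc, ← h]
  group

theorem pcomm_mul_left {x y g : G} (h : pcomm x g ∈ Subgroup.center G) :
    pcomm (x * y) g = pcomm x g * pcomm y g := by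
  have h1 : pcomm (x * y) g = y⁻¹ * pcomm x g * (g⁻¹ * y * g) := by
    simp only [pcomm]; group
  rw [h1, Subgroup.mem_center_iff.1 h]
  simp only [pcomm]; group

theorem pcomm_mul_right {x y g : G} (h : pcomm g x ∈ Subgroup.center G) :
    pcomm g (x * y) = pcomm g x * pcomm g y := by
  have h1 : pcomm g (x * y) = (g⁻¹ * y⁻¹ * g) * pcomm g x * y := by
    simp only [pcomm]; group
  rw [h1, Subgroup.mem_center_iff.1 h]
  simp only [pcomm]; group

theorem pcomm_zpow_left {x g : G} (h : pcomm x g ∈ Subgroup.center G) (k : ℤ) :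
    pcomm (x ^ k) g = pcomm x g ^ k := by
  have h1 : g⁻¹ * x * g = x * pcomm x g := by simp only [pcomm]; group
  have h2 : g⁻¹ * x ^ k * g = (g⁻¹ * x * g) ^ k := by
    have := conj_zpow (i := k) (a := g⁻¹) (b := x)
    rw [inv_inv] at this
    exact this.symm
  have h3 : Commute x (pcomm x g) := Subgroup.mem_center_iff.1 h x
  have h4 : pcomm (x ^ k) g = (x ^ k)⁻¹ * (g⁻¹ * x ^ k * g) := by simp only [pcomm, mul_assoc]
  rw [h4, h2, h1, h3.mul_zpow, inv_mul_cancel_left]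

theorem pcomm_zpow_right {x g : G} (h : pcomm g x ∈ Subgroup.center G) (k : ℤ) :
    pcomm g (x ^ k) = pcomm g x ^ k := by
  have h' : pcomm x g ∈ Subgroup.center G := by
    rw [← pcomm_inv]; exact inv_mem h
  rw [← pcomm_inv, pcomm_zpow_left h', ← pcomm_inv g x, inv_zpow, inv_inv]

/-- The commutator of two words in normal form, in a group where commutators are central. -/
theorem pcomm_normal_form (hc : ∀ x y : G, pcomm x y ∈ Subgroup.center G) {a b g h : G}
    (hg : g ∈ Subgroup.center G) (hh : h ∈ Subgroup.center G) (i j s t : ℤ) :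
    pcomm (a ^ i * b ^ j * g) (a ^ s * b ^ t * h) = pcomm a b ^ (i * t - j * s) := by
  have hr : ∀ x : G, pcomm x h = 1 := fun x => by
    rw [← pcomm_inv, pcomm_eq_one_of_mem_center_left hh, inv_one]
  rw [pcomm_mul_left (hc _ _), pcomm_mul_left (hc _ _), pcomm_eq_one_of_mem_center_left hg,
    pcomm_zpow_left (hc _ _), pcomm_zpow_left (hc _ _),
    pcomm_mul_right (hc _ _), pcomm_mul_right (hc _ _), pcomm_mul_right (hc _ _),
    pcomm_mul_right (hc _ _), hr, hr, pcomm_zpow_right (hc _ _), pcomm_zpow_right (hc _ _),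
    pcomm_zpow_right (hc _ _), pcomm_zpow_right (hc _ _), pcomm_self, pcomm_self, ← pcomm_inv a b]
  simp only [one_zpow, one_mul, mul_one, inv_zpow', ← zpow_mul, ← zpow_add]
  congr 1
  ring

/-- Hall's collection formula for `(x * y) ^ k` in a group of class at most three. -/
theorem mul_pow_collect {x y d e f : G} (hd : y * x = x * y * d) (he : d * x = x * d * e)
    (hf : d * y = y * d * f) (hec : ∀ g, Commute e g) (hfc : ∀ g, Commute f g) (k : ℕ) :
    (x * y) ^ k = x ^ k * y ^ k * d ^ k.choose 2 * e ^ k.choose 3 *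
      f ^ (k.choose 2 + 2 * k.choose 3) := by
  have hdx : ∀ k : ℕ, d ^ k * x = x * d ^ k * e ^ k := fun k => by
    have h : SemiconjBy x (d * e) d := by rw [SemiconjBy, he, mul_assoc]
    rw [← (h.pow_right k).eq, (hec d).symm.mul_pow, mul_assoc]
  have hdy : ∀ k : ℕ, d ^ k * y = y * d ^ k * f ^ k := fun k => by
    have h : SemiconjBy y (d * f) d := by rw [SemiconjBy, hf, mul_assoc]
    rw [← (h.pow_right k).eq, (hfc d).symm.mul_pow, mul_assoc]
  -- Each y that x passes leaves a d; moving the d's past the remaining y's contributes 0 + 1 + ...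
  -- + (k - 1) factors f.
  have hyx : ∀ k : ℕ, y ^ k * x = x * y ^ k * d ^ k * f ^ k.choose 2 := fun k => by
    induction k with
    | zero => simp
    | succ k ih =>
      have hch : (k + 1).choose 2 = k + k.choose 2 := by
        simp [Nat.choose_succ_succ' k 1]
      calc y ^ (k + 1) * x = y ^ k * (y * x) := by rw [pow_succ, mul_assoc]
        _ = (y ^ k * x) * y * d := by rw [hd]; simp only [mul_assoc]
        _ = x * y ^ k * d ^ k * (f ^ k.choose 2 * (y * d)) := by rw [ih]; simp only [mul_assoc]
        _ = x * y ^ k * (d ^ k * y) * d * f ^ k.choose 2 := by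
          rw [((hfc (y * d)).pow_left _).eq]; simp only [mul_assoc]
        _ = x * y ^ k * y * d ^ k * (f ^ k * d) * f ^ k.choose 2 := by
          rw [hdy]; simp only [mul_assoc]
        _ = x * y ^ (k + 1) * d ^ (k + 1) * f ^ (k + 1).choose 2 := by
          rw [((hfc d).pow_left _).eq, hch, pow_add f, pow_succ, pow_succ]
          simp only [mul_assoc]
  induction k with
  | zero => simp
  | succ k ih =>
    have hch : (k + 1).choose 2 = k + k.choose 2 := by
      simp [Nat.choose_succ_succ' k 1]
    have hch3 : (k + 1).choose 3 = k.choose 2 + k.choose 3 := Nat.choose_succ_succ' k 2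
    set α := k.choose 2
    set β := k.choose 3
    have hE : ∀ g, Commute (e ^ β * f ^ (α + 2 * β)) g := fun g =>
      ((hec g).pow_left _).mul_left ((hfc g).pow_left _)
    calc (x * y) ^ (k + 1)
        = x ^ k * y ^ k * d ^ α * (e ^ β * f ^ (α + 2 * β) * (x * y)) := by
          rw [pow_succ, ih]; simp only [mul_assoc]
      _ = x ^ k * y ^ k * (d ^ α * x) * y * (e ^ β * f ^ (α + 2 * β)) := by
          rw [(hE _).eq]; simp only [mul_assoc]
      _ = x ^ k * (y ^ k * x) * d ^ α * (e ^ α * y) * (e ^ β * f ^ (α + 2 * β)) := by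
          rw [hdx]; simp only [mul_assoc]
      _ = x ^ k * x * y ^ k * d ^ k * (f ^ α * (d ^ α * y)) * e ^ α *
            (e ^ β * f ^ (α + 2 * β)) := by
          rw [hyx, ((hec y).pow_left α).eq]; simp only [mul_assoc]; rfl
      _ = x ^ (k + 1) * y ^ k * (d ^ (k + α) * y) * f ^ α * e ^ α *
            (e ^ β * f ^ (α + 2 * β)) := by
          rw [((hfc (d ^ α * y)).pow_left α).eq, pow_succ, pow_add d]; simp only [mul_assoc]
      _ = x ^ (k + 1) * y ^ (k + 1) * d ^ (k + α) * (f ^ (k + α) * f ^ α * (e ^ α * e ^ β)) *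
             f ^ (α + 2 * β) := by
          rw [hdy, pow_succ y]; simp only [mul_assoc]
      _ = _ := by
          rw [← pow_add, ← pow_add, ((hfc (e ^ (α + β))).pow_left _).eq, hch, hch3,
            show k + α + 2 * (α + β) = (k + α + α) + (α + 2 * β) by ring, pow_add f (k + α + α)]
          simp only [mul_assoc]

end Commutator

/-! ### Divisibility of binomial coefficients -/

section Divisibility

variable {p N : ℕ}

theorem sq_dvd_choose_two_prime_pow (hp : p.Prime) (h2 : 2 < p) (hN : 2 ≤ N) :
    p ^ 2 ∣ (p ^ N).choose 2 := by
  obtain ⟨q, hq⟩ : ∃ q, p ^ N = q + 1 := Nat.exists_eq_succ_of_ne_zero (pow_ne_zero _ hp.ne_zero)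
  have h := Nat.add_one_mul_choose_eq q 1
  rw [← hq] at h
  have hd : p ^ 2 ∣ (p ^ N).choose 2 * 2 := h ▸ Dvd.dvd.mul_right (pow_dvd_pow p hN) _
  refine Nat.Coprime.dvd_of_dvd_mul_right (Nat.Coprime.pow_left _ ?_) hd
  exact (Nat.coprime_primes hp Nat.prime_two).2 h2.ne'

theorem dvd_choose_three_prime_pow (hp : p.Prime) (hN : 2 ≤ N) :
    p ∣ (p ^ N).choose 3 := by
  obtain ⟨q, hq⟩ : ∃ q, p ^ N = q + 1 := Nat.exists_eq_succ_of_ne_zero (pow_ne_zero _ hp.ne_zero)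
  have h := Nat.add_one_mul_choose_eq q 2
  rw [← hq] at h
  have hd : p ^ 2 ∣ (p ^ N).choose 3 * 3 := h ▸ Dvd.dvd.mul_right (pow_dvd_pow p hN) _
  -- For p = 3 the denominator 3 costs one factor p, which the exponent N ≥ 2 can spare.
  by_cases h3 : p = 3
  · subst h3
    rw [pow_two] at hd
    exact Nat.dvd_of_mul_dvd_mul_right (by norm_num) hd
  · refine Nat.Coprime.dvd_of_dvd_mul_right ((Nat.coprime_primes hp Nat.prime_three).2 h3)
      ((dvd_pow_self p two_ne_zero).trans hd)

end Divisibility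

/-! ### Two-generator groups: normal forms, order bounds, normality -/

section Generation

variable {G : Type*} [Group G]

theorem exists_zpow_mul_zpow_of_commute {a b : G} (h : Commute a b)
    (hg : Subgroup.closure {a, b} = ⊤) (x : G) : ∃ i j : ℤ, x = a ^ i * b ^ j := by
  have hx : x ∈ Subgroup.closure {a, b} := hg ▸ Subgroup.mem_top x
  induction hx using Subgroup.closure_induction with
  | mem x hx =>
    rcases hx with rfl | rfl
    · exact ⟨1, 0, by simp⟩
    · exact ⟨0, 1, by simp⟩
  | one => exact ⟨0, 0, by simp⟩
  | mul x y _ _ hx hy =>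
    obtain ⟨i, j, rfl⟩ := hx
    obtain ⟨k, l, rfl⟩ := hy
    refine ⟨i + k, j + l, ?_⟩
    rw [zpow_add, zpow_add, mul_assoc, ← mul_assoc (b ^ j), ((h.zpow_zpow k j).eq).symm]
    simp only [mul_assoc]
  | inv x _ hx =>
    obtain ⟨i, j, rfl⟩ := hx
    refine ⟨-i, -j, ?_⟩
    rw [mul_inv_rev, ← zpow_neg, ← zpow_neg, (h.zpow_zpow _ _).eq]

/-- If `N` is normal and contains `[a, b]`, every element of `⟨a, b⟩` is `a ^ i * b ^ j * g` with
`g ∈ N`. -/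
theorem exists_normal_form {a b : G} (hg : Subgroup.closure {a, b} = ⊤) (N : Subgroup G)
    [N.Normal] (hN : pcomm a b ∈ N) (x : G) :
    ∃ i j : ℤ, ∃ g ∈ N, x = a ^ i * b ^ j * g := by
  have hcomm : Commute (QuotientGroup.mk' N a) (QuotientGroup.mk' N b) := by
    have h := (QuotientGroup.eq_one_iff (N := N) (pcomm a b)).2 hN
    have h' := congrArg (QuotientGroup.mk' N) (mul_mul_pcomm a b)
    rw [map_mul, map_mul, map_mul, QuotientGroup.mk'_apply, QuotientGroup.mk'_apply,
      QuotientGroup.mk'_apply, h, mul_one] at h'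
    exact h'.symm
  have hgen : Subgroup.closure {QuotientGroup.mk' N a, QuotientGroup.mk' N b} = ⊤ := by
    rw [← Set.image_pair, ← MonoidHom.map_closure, hg,
      Subgroup.map_top_of_surjective _ (QuotientGroup.mk'_surjective N)]
  obtain ⟨i, j, h⟩ := exists_zpow_mul_zpow_of_commute hcomm hgen (QuotientGroup.mk' N x)
  refine ⟨i, j, (a ^ i * b ^ j)⁻¹ * x, ?_, by group⟩
  rw [← map_zpow, ← map_zpow, ← map_mul] at h
  exact QuotientGroup.eq.1 h.symm

/-- In the normal form modulo N the exponents can be reduced modulo P and Q; the corrections lie in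
N and move to the right by normality. -/
theorem card_le_of_generators [Finite G] {a b : G} (hg : Subgroup.closure {a, b} = ⊤)
    (N : Subgroup G) [N.Normal] (hN : pcomm a b ∈ N) {P Q : ℕ} (hP : 0 < P) (hQ : 0 < Q)
    (ha : a ^ P ∈ N) (hb : b ^ Q ∈ N) : Nat.card G ≤ P * Q * Nat.card N := by
  have hPz : (0 : ℤ) < P := by exact_mod_cast hP
  have hQz : (0 : ℤ) < Q := by exact_mod_cast hQ
  have key : ∀ (y : G) (R : ℕ), 0 < R → y ^ R ∈ N → ∀ i : ℤ, ∃ k : Fin R, ∃ g ∈ N,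
      y ^ i = y ^ (k : ℕ) * g := by
    intro y R hR hy i
    have hRz : (0 : ℤ) < R := by exact_mod_cast hR
    have h0 := Int.emod_nonneg i hRz.ne'
    refine ⟨⟨(i % R).toNat, ?_⟩, (y ^ R) ^ (i / R), N.zpow_mem hy _, ?_⟩
    · have := Int.emod_lt_of_pos i hRz; omega
    · rw [← zpow_natCast, ← zpow_natCast, ← zpow_mul, ← zpow_add]
      congr 1
      simp only [Int.toNat_of_nonneg h0]
      exact (Int.emod_add_mul_ediv i R).symm
  have hsurj : Function.Surjective
      (fun x : (Fin P × Fin Q) × N => a ^ (x.1.1 : ℕ) * b ^ (x.1.2 : ℕ) * (x.2 : G)) := by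
    intro x
    obtain ⟨i, j, g, hgN, rfl⟩ := exists_normal_form hg N hN x
    obtain ⟨k, u, hu, hk⟩ := key a P hP ha i
    obtain ⟨l, v, hv, hl⟩ := key b Q hQ hb j
    refine ⟨⟨⟨k, l⟩, ⟨((b ^ (l : ℕ))⁻¹ * u * b ^ (l : ℕ)) * v * g, ?_⟩⟩, ?_⟩
    · have := ‹N.Normal›.conj_mem u hu (b ^ (l : ℕ))⁻¹
      rw [inv_inv] at this
      exact mul_mem (mul_mem this hv) hgN
    · simp only [hk, hl]; group
  have := Nat.card_le_card_of_surjective _ hsurj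
  simpa [Nat.card_prod] using this

/-- Centrality of [c, s] gives s c s⁻¹ = c [c, s]⁻¹. Conjugation by x and by x⁻¹ are followed
together, so the inverse step of the closure induction is a swap. -/
theorem normal_of_conj_generators {S : Set G} (hS : Subgroup.closure S = ⊤) {c : G}
    (h : ∀ s ∈ S, pcomm c s ∈ Subgroup.center G ∧ pcomm c s ∈ Subgroup.zpowers c) :
    (Subgroup.zpowers c).Normal := by
  have hconj : ∀ s : G, (s * c * s⁻¹ ∈ Subgroup.zpowers c ∧ s⁻¹ * c * s ∈ Subgroup.zpowers c) →
      ∀ g ∈ Subgroup.zpowers c, s * g * s⁻¹ ∈ Subgroup.zpowers c ∧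
        s⁻¹ * g * s ∈ Subgroup.zpowers c := by
    rintro s ⟨h1, h2⟩ g ⟨k, rfl⟩
    constructor
    · simp only [← conj_zpow]; exact Subgroup.zpow_mem _ h1 _
    · have := conj_zpow (i := k) (a := s⁻¹) (b := c)
      rw [inv_inv] at this
      simp only [← this]; exact Subgroup.zpow_mem _ h2 _
  have hall : ∀ x : G, x * c * x⁻¹ ∈ Subgroup.zpowers c ∧ x⁻¹ * c * x ∈ Subgroup.zpowers c := by
    intro x
    have hx : x ∈ Subgroup.closure S := hS ▸ Subgroup.mem_top x
    induction hx using Subgroup.closure_induction with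
    | mem s hs =>
      obtain ⟨hc, hz⟩ := h s hs
      have h1 : s * c * s⁻¹ = c * (pcomm c s)⁻¹ := by
        have h2 : s * c * pcomm c s = c * s := mul_mul_pcomm c s
        rw [eq_mul_inv_iff_mul_eq, mul_assoc, Subgroup.mem_center_iff.1 hc, ← mul_assoc, h2]
        group
      have h2 : s⁻¹ * c * s = c * pcomm c s := by simp only [pcomm]; group
      rw [h1, h2]
      exact ⟨mul_mem (Subgroup.mem_zpowers c) (inv_mem hz), mul_mem (Subgroup.mem_zpowers c) hz⟩
    | one => simp
    | mul x y _ _ hx hy =>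
      constructor
      · have := (hconj x hx _ hy.1).1
        rwa [show x * y * c * (x * y)⁻¹ = x * (y * c * y⁻¹) * x⁻¹ by group]
      · have := (hconj y hy _ hx.2).2
        rwa [show (x * y)⁻¹ * c * (x * y) = y⁻¹ * (x⁻¹ * c * x) * y by group]
    | inv x _ hx => rw [inv_inv]; exact hx.symm
  exact ⟨fun g hg x => (hconj x (hall x) g hg).1⟩

end Generation

section

variable {G : Type*} [Group G]

/-- The quotient by N is generated by two commuting elements, hence abelian. -/
theorem commutator_le_of_generators {a b : G} (hg : Subgroup.closure {a, b} = ⊤)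
    (N : Subgroup G) [N.Normal] (hN : pcomm a b ∈ N) : commutator G ≤ N := by
  rw [← Subgroup.Normal.quotient_commutative_iff_commutator_le]
  have hcomm : Commute (a : G ⧸ N) (b : G ⧸ N) := by
    have h := (QuotientGroup.eq_one_iff (N := N) (pcomm a b)).2 hN
    have h' := congrArg (QuotientGroup.mk' N) (mul_mul_pcomm a b)
    rw [map_mul, map_mul, map_mul, QuotientGroup.mk'_apply, QuotientGroup.mk'_apply,
      QuotientGroup.mk'_apply, h, mul_one] at h'
    exact h'.symm
  have hform : ∀ x : G ⧸ N, ∃ i j : ℤ, x = (a : G ⧸ N) ^ i * (b : G ⧸ N) ^ j := by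
    intro x
    obtain ⟨x, rfl⟩ := QuotientGroup.mk_surjective x
    obtain ⟨i, j, g, hgN, rfl⟩ := exists_normal_form hg N hN x
    refine ⟨i, j, ?_⟩
    rw [QuotientGroup.mk_mul, (QuotientGroup.eq_one_iff g).2 hgN, mul_one]
    rfl
  refine ⟨⟨fun x y => ?_⟩⟩
  obtain ⟨i, j, rfl⟩ := hform x
  obtain ⟨k, l, rfl⟩ := hform y
  exact Commute.mul_left
    (((Commute.refl _).zpow_zpow i k).mul_right (hcomm.zpow_zpow i l))
    ((hcomm.symm.zpow_zpow j k).mul_right ((Commute.refl _).zpow_zpow j l))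

theorem mem_center_of_commute_generators {a b : G} (hg : Subgroup.closure {a, b} = ⊤) {z : G}
    (ha : Commute a z) (hb : Commute b z) : z ∈ Subgroup.center G := by
  rw [Subgroup.mem_center_iff]
  intro g
  have : Subgroup.closure {a, b} ≤ Subgroup.centralizer {z} := by
    rw [Subgroup.closure_le]
    rintro x (rfl | rfl)
    · exact Subgroup.mem_centralizer_singleton_iff.2 ha.eq
    · exact Subgroup.mem_centralizer_singleton_iff.2 hb.eq
  rw [hg] at this
  exact Subgroup.mem_centralizer_singleton_iff.1 (this (Subgroup.mem_top g))

end

/-! ### The group M_p(n, m, 1) -/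

namespace Mp

variable {p n m : ℕ}

theorem relations : (PresentedGroup.of MpGen.a : Mp p n m) ^ p ^ n = 1 ∧
    (PresentedGroup.of MpGen.b : Mp p n m) ^ p ^ m = 1 ∧
    (PresentedGroup.of MpGen.c : Mp p n m) ^ p = 1 ∧
    pcomm (PresentedGroup.of MpGen.a : Mp p n m) (PresentedGroup.of MpGen.b : Mp p n m) =
      (PresentedGroup.of MpGen.c : Mp p n m) ∧
    pcomm (PresentedGroup.of MpGen.c : Mp p n m) (PresentedGroup.of MpGen.a : Mp p n m) = 1 ∧
    pcomm (PresentedGroup.of MpGen.c : Mp p n m) (PresentedGroup.of MpGen.b : Mp p n m) = 1 := by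
  have h : ∀ r ∈ MpRels p n m, PresentedGroup.mk (MpRels p n m) r = 1 := fun r hr =>
    PresentedGroup.one_of_mem hr
  simp only [MpRels, Set.mem_insert_iff, Set.mem_singleton_iff, forall_eq_or_imp, forall_eq]
    at h
  obtain ⟨h1, h2, h3, h4, h5, h6⟩ := h
  exact ⟨h1, h2, h3, mul_inv_eq_one.1 h4, h5, h6⟩

theorem closure_eq_top : Subgroup.closure
    {(PresentedGroup.of MpGen.a : Mp p n m), (PresentedGroup.of MpGen.b : Mp p n m)} = ⊤ := by
  rw [eq_top_iff, ← PresentedGroup.closure_range_of, Subgroup.closure_le]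
  have ha : (PresentedGroup.of MpGen.a : Mp p n m) ∈ Subgroup.closure
      {(PresentedGroup.of MpGen.a : Mp p n m), (PresentedGroup.of MpGen.b : Mp p n m)} :=
    Subgroup.subset_closure (by simp)
  have hb : (PresentedGroup.of MpGen.b : Mp p n m) ∈ Subgroup.closure
      {(PresentedGroup.of MpGen.a : Mp p n m), (PresentedGroup.of MpGen.b : Mp p n m)} :=
    Subgroup.subset_closure (by simp)
  rintro _ ⟨x, rfl⟩
  cases x with
  | a => exact ha
  | b => exact hb
  | c =>
    rw [← relations.2.2.2.1]
    exact mul_mem (mul_mem (mul_mem (inv_mem ha) (inv_mem hb)) ha) hb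

theorem commutator_le : commutator (Mp p n m) ≤
    Subgroup.zpowers (PresentedGroup.of MpGen.c : Mp p n m) := by
  obtain ⟨-, -, -, h, ha, hb⟩ := relations (p := p) (n := n) (m := m)
  have : (Subgroup.zpowers (PresentedGroup.of MpGen.c : Mp p n m)).Normal := by
    refine normal_of_conj_generators closure_eq_top ?_
    rintro s (rfl | rfl)
    · rw [ha]; exact ⟨one_mem _, one_mem _⟩
    · rw [hb]; exact ⟨one_mem _, one_mem _⟩
  refine commutator_le_of_generators closure_eq_top _ ?_
  rw [h]; exact Subgroup.mem_zpowers _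

/-- The abelianization of `M_p(n, m, 1)` maps onto `ℤ/pⁿ × ℤ/pᵐ`. -/
theorem exists_proj (p n m : ℕ) : ∃ f : Mp p n m →*
    Multiplicative (ZMod (p ^ n)) × Multiplicative (ZMod (p ^ m)),
    f (PresentedGroup.of MpGen.a : Mp p n m) = (Multiplicative.ofAdd 1, 1) ∧
    f (PresentedGroup.of MpGen.b : Mp p n m) = (1, Multiplicative.ofAdd 1) := by
  let g : MpGen → Multiplicative (ZMod (p ^ n)) × Multiplicative (ZMod (p ^ m)) := fun x =>
    match x with
    | .a => (Multiplicative.ofAdd 1, 1)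
    | .b => (1, Multiplicative.ofAdd 1)
    | .c => 1
  have hn : (Multiplicative.ofAdd (1 : ZMod (p ^ n))) ^ p ^ n = 1 := by
    rw [← ofAdd_nsmul, nsmul_one, ZMod.natCast_self, ofAdd_zero]
  have hm : (Multiplicative.ofAdd (1 : ZMod (p ^ m))) ^ p ^ m = 1 := by
    rw [← ofAdd_nsmul, nsmul_one, ZMod.natCast_self, ofAdd_zero]
  have hg : ∀ r ∈ MpRels p n m, FreeGroup.lift g r = 1 := by
    simp only [MpRels, Set.mem_insert_iff, Set.mem_singleton_iff, forall_eq_or_imp, forall_eq,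
      map_mul, map_inv, map_pow, map_pcomm, FreeGroup.lift_apply_of]
    refine ⟨?_, ?_, ?_, ?_, ?_, ?_⟩
    · simp only [g, Prod.pow_mk, hn, one_pow, Prod.mk_one_one]
    · simp only [g, Prod.pow_mk, hm, one_pow, Prod.mk_one_one]
    all_goals simp [g, pcomm]
  exact ⟨PresentedGroup.toGroup hg, PresentedGroup.toGroup.of hg, PresentedGroup.toGroup.of hg⟩

end Mp

/-! ### From the Frattini hypotheses to explicit structure -/

/-- The structural information carried by characteristic generators `a, b` with characteristic
matrix `w`. -/
structure CharData (p n m : ℕ) {G : Type*} [Group G] (w : Matrix (Fin 2) (Fin 2) (ZMod p))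
    (a b : G) : Prop where
  closure_eq_top : Subgroup.closure {a, b} = ⊤
  orderOf_eq : orderOf (pcomm a b) = p ^ 2
  commutator_eq : commutator G = Subgroup.zpowers (pcomm a b)
  pow_mem_center : pcomm a b ^ p ∈ Subgroup.center G
  pcomm_mem : ∀ g ∈ commutator G, ∀ x : G, pcomm g x ∈ Subgroup.zpowers (pcomm a b ^ p)
  exists_proj : ∃ f : G →* Multiplicative (ZMod (p ^ n)) × Multiplicative (ZMod (p ^ m)),
    f a = (Multiplicative.ofAdd 1, 1) ∧ f b = (1, Multiplicative.ofAdd 1)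
  left_pow : a ^ p ^ n = pcomm a b ^ ((w 0 0).val * p)
  right_pow : b ^ p ^ m = pcomm a b ^ ((w 1 0).val * p)
  pcomm_left : pcomm (pcomm a b) a = pcomm a b ^ ((w 0 1).val * p)
  pcomm_right : pcomm (pcomm a b) b = pcomm a b ^ ((w 1 1).val * p)

/-- Conjugation by x sends c to c^(1 + kp), so it sends c ^ p to c^(p + kp²) = c ^ p. -/
theorem commute_pow_of_pcomm_eq {G : Type*} [Group G] {c x : G} {p k : ℕ} (hc : c ^ p ^ 2 = 1)
    (h : pcomm c x = c ^ (k * p)) : Commute x (c ^ p) := by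
  have h1 : x * (c * c ^ (k * p)) = c * x := by
    rw [← h, ← mul_assoc]; exact mul_mul_pcomm c x
  have h2 : SemiconjBy x (c * c ^ (k * p)) c := h1
  have h3 := h2.pow_right p
  rwa [← pow_succ', ← pow_mul, show (k * p + 1) * p = p ^ 2 * k + p by ring, pow_add, pow_mul, hc,
    one_pow, one_mul] at h3

theorem InClass.charData {p n m : ℕ} [hp : Fact p.Prime] {G : Type*} [Group G]
    (hG : InClass p n m G) {w : Matrix (Fin 2) (Fin 2) (ZMod p)} {a b : G}
    (hab : IsCharGenerators p n m a b)
    (h1 : a ^ p ^ n = pcomm a b ^ ((w 0 0).val * p))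
    (h2 : b ^ p ^ m = pcomm a b ^ ((w 1 0).val * p))
    (h3 : pcomm (pcomm a b) a = pcomm a b ^ ((w 0 1).val * p))
    (h4 : pcomm (pcomm a b) b = pcomm a b ^ ((w 1 1).val * p)) : CharData p n m w a b := by
  have := hG.finite
  obtain ⟨φ, hφa, hφb⟩ := hab
  let ψ : G →* Mp p n m := φ.toMonoidHom.comp (QuotientGroup.mk' (derivedFrattini G))
  have hψa : ψ a = PresentedGroup.of MpGen.a := hφa
  have hψb : ψ b = PresentedGroup.of MpGen.b := hφb
  have hker : ∀ x, ψ x = 1 ↔ x ∈ derivedFrattini G := fun x => by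
    rw [← QuotientGroup.eq_one_iff]
    exact φ.map_eq_one_iff
  have hcard : Nat.card (derivedFrattini G) = p := by
    obtain ⟨e⟩ := hG.frattini_equiv
    rw [Nat.card_congr e.toEquiv]
    exact Nat.card_zmod p
  obtain ⟨r1, r2, r3, r4, r5, r6⟩ := Mp.relations (p := p) (n := n) (m := m)
  set c := pcomm a b with hc
  have hψc : ψ c = PresentedGroup.of MpGen.c := by rw [hc, map_pcomm, hψa, hψb, r4]
  have hcp : c ^ p ∈ derivedFrattini G := by rw [← hker, map_pow, hψc, r3]
  have hle : derivedFrattini G ≤ commutator G := Subgroup.map_subtype_le _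
  have hcG : c ∈ commutator G := pcomm_mem_commutator a b
  have hnon : ∀ K : Subgroup (commutator G), K ⊔ frattini (commutator G) = ⊤ → K = ⊤ :=
    fun K => frattini_nongenerating
  -- The element c generates G' modulo Φ(G'), and Frattini elements are non-generators.
  have hcomm : commutator G = Subgroup.zpowers c := by
    refine le_antisymm ?_ (by rwa [Subgroup.zpowers_le])
    have htop : Subgroup.zpowers (⟨c, hcG⟩ : commutator G) = ⊤ := by
      refine hnon _ ?_
      rw [eq_top_iff]
      rintro ⟨g, hg⟩ -
      have hg' : ψ g ∈ commutator (Mp p n m) := by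
        have h := Subgroup.mem_map_of_mem ψ hg
        rw [commutator_def, Subgroup.map_commutator] at h
        exact Subgroup.commutator_mono le_top le_top h
      obtain ⟨k, hk⟩ := Mp.commutator_le hg'
      have hu : (c ^ k)⁻¹ * g ∈ derivedFrattini G := by
        rw [← hker, map_mul, map_inv, map_zpow, hψc, ← hk, inv_mul_cancel]
      obtain ⟨u, hu, hu'⟩ := hu
      have : (⟨g, hg⟩ : commutator G) = (⟨c, hcG⟩ : commutator G) ^ k * u := by
        ext
        simp only [Subgroup.coe_mul, SubgroupClass.coe_zpow]
        rw [show (u : G) = (c ^ k)⁻¹ * g from hu', mul_inv_cancel_left]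
      rw [this]
      exact Subgroup.mul_mem_sup (Subgroup.zpow_mem _ (Subgroup.mem_zpowers _) _) hu
    intro g hg
    have : (⟨g, hg⟩ : commutator G) ∈ Subgroup.zpowers (⟨c, hcG⟩ : commutator G) :=
      htop ▸ Subgroup.mem_top _
    obtain ⟨k, hk⟩ := this
    exact ⟨k, congrArg Subtype.val hk⟩
  -- If Φ(G') = G', the trivial subgroup would already generate G', which would then not have order
  -- p.
  have hne : derivedFrattini G ≠ commutator G := by
    intro h
    have hf : frattini (commutator G) = ⊤ := by
      rw [eq_top_iff]
      rintro ⟨g, hg⟩ -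
      obtain ⟨u, hu, hu'⟩ := h.ge hg
      rwa [← show u = ⟨g, hg⟩ from Subtype.ext hu']
    have hbot := hnon ⊥ (by rw [hf, bot_sup_eq])
    have hsub : Nat.card (commutator G) = 1 := by
      rw [← Subgroup.card_top, ← hbot, Subgroup.card_bot]
    rw [← h, hcard] at hsub
    exact hp.out.one_lt.ne' hsub
  have hcpp : c ^ p ^ 2 = 1 := by
    have h : (⟨c ^ p, hcp⟩ : derivedFrattini G) ^ Nat.card (derivedFrattini G) = 1 :=
      pow_card_eq_one'
    rw [hcard] at h
    have := congrArg Subtype.val h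
    simpa [← pow_mul, pow_two] using this
  have hord : orderOf c = p ^ 2 := by
    -- Otherwise |G'| ≤ p = |Φ(G')|, forcing Φ(G') = G'.
    have hpow : c ^ p ^ 1 ≠ 1 := by
      intro h
      apply hne
      refine Subgroup.eq_of_le_of_card_ge hle ?_
      rw [hcomm, Nat.card_zpowers, hcard]
      exact Nat.le_of_dvd hp.out.pos (orderOf_dvd_of_pow_eq_one (by rwa [pow_one] at h))
    exact orderOf_eq_prime_pow hpow hcpp
  have hordp : orderOf (c ^ p) = p := by
    rw [orderOf_pow_of_dvd hp.out.ne_zero (hord ▸ dvd_pow_self p two_ne_zero), hord, pow_two,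
      Nat.mul_div_cancel _ hp.out.pos]
  have hfrat : derivedFrattini G = Subgroup.zpowers (c ^ p) := by
    refine (Subgroup.eq_of_le_of_card_ge (by rwa [Subgroup.zpowers_le]) ?_).symm
    rw [hcard, Nat.card_zpowers, hordp]
  have hcl : Subgroup.closure {a, b} = ⊤ := by
    have ha : a ∈ Subgroup.closure {a, b} := Subgroup.subset_closure (by simp)
    have hb : b ∈ Subgroup.closure {a, b} := Subgroup.subset_closure (by simp)
    have hmap : (Subgroup.closure {a, b}).map ψ = ⊤ := by
      rw [MonoidHom.map_closure, Set.image_pair, hψa, hψb, Mp.closure_eq_top]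
    rw [eq_top_iff]
    intro x _
    obtain ⟨y, hy, hyx⟩ : ψ x ∈ (Subgroup.closure {a, b}).map ψ := hmap ▸ Subgroup.mem_top _
    have hu : y⁻¹ * x ∈ derivedFrattini G := by
      rw [← hker, map_mul, map_inv, hyx, inv_mul_cancel]
    rw [hfrat] at hu
    have hle' : Subgroup.zpowers (c ^ p) ≤ Subgroup.closure {a, b} := by
      rw [Subgroup.zpowers_le]
      exact pow_mem (mul_mem (mul_mem (mul_mem (inv_mem ha) (inv_mem hb)) ha) hb) _
    have := mul_mem hy (hle' hu)
    rwa [mul_inv_cancel_left] at this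
  refine ⟨hcl, hord, hcomm, ?_, ?_, ?_, h1, h2, h3, h4⟩
  · exact mem_center_of_commute_generators hcl (commute_pow_of_pcomm_eq hcpp h3)
      (commute_pow_of_pcomm_eq hcpp h4)
  · intro g hg x
    rw [← hfrat]
    apply hG.third_le
    rw [Subgroup.lowerCentralSeries_succ, Subgroup.lowerCentralSeries_succ,
      Subgroup.lowerCentralSeries_zero, pcomm_eq_commutatorElement]
    exact Subgroup.commutator_mem_commutator (inv_mem hg) (Subgroup.mem_top _)
  · obtain ⟨f, hfa, hfb⟩ := Mp.exists_proj p n m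
    exact ⟨f.comp ψ, by simp [hψa, hfa], by simp [hψb, hfb]⟩

/-- D is invertible modulo p^k, so x is itself a power of x ^ D. -/
theorem mem_of_zpow_mem_of_coprime {G : Type*} [Group G] {S : Subgroup G} {x : G} {p k : ℕ}
    {D : ℤ} (hx : x ^ p ^ k = 1) (hD : IsCoprime D (p : ℤ)) (h : x ^ D ∈ S) : x ∈ S := by
  obtain ⟨u, v, huv⟩ := hD.pow_right (n := k)
  have : x = (x ^ D) ^ u := by
    conv_lhs => rw [← zpow_one x, ← huv, zpow_add, mul_comm u, zpow_mul, mul_comm v, zpow_mul,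
      ← Nat.cast_pow, zpow_natCast, hx, one_zpow, mul_one]
  rw [this]
  exact S.zpow_mem h u

theorem zpow_eq_zpow_iff_zmod {G : Type*} [Group G] {z : G} {p : ℕ} (hz : orderOf z = p)
    (k l : ℤ) : z ^ k = z ^ l ↔ (k : ZMod p) = l := by
  rw [zpow_eq_zpow_iff_modEq, hz, ZMod.intCast_eq_intCast_iff]

/-! ### Powers and commutators of normal forms -/

namespace CharData

variable {p n m : ℕ} {G : Type*} [Group G]
  {w : Matrix (Fin 2) (Fin 2) (ZMod p)} {a b : G}

theorem orderOf_pow [hp : Fact p.Prime] (h : CharData p n m w a b) : orderOf (pcomm a b ^ p) = p := by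
  rw [orderOf_pow_of_dvd hp.out.ne_zero (h.orderOf_eq ▸ dvd_pow_self p two_ne_zero),
    h.orderOf_eq, pow_two, Nat.mul_div_cancel _ hp.out.pos]

theorem zpowers_le_center (h : CharData p n m w a b) :
    Subgroup.zpowers (pcomm a b ^ p) ≤ Subgroup.center G := by
  rw [Subgroup.zpowers_le]; exact h.pow_mem_center

theorem pow_sq_eq_one (h : CharData p n m w a b) : pcomm a b ^ p ^ 2 = 1 := by
  rw [← h.orderOf_eq, pow_orderOf_eq_one]

theorem pow_eq_one_of_mem (h : CharData p n m w a b) {u : G}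
    (hu : u ∈ Subgroup.zpowers (pcomm a b ^ p)) : u ^ p = 1 := by
  obtain ⟨k, rfl⟩ := hu
  simp only
  rw [← zpow_natCast, ← zpow_mul, mul_comm, zpow_mul, zpow_natCast, ← pow_mul, ← pow_two,
    h.pow_sq_eq_one, one_zpow]

theorem pow_sq_eq_one_of_mem (h : CharData p n m w a b) {g : G} (hg : g ∈ commutator G) :
    g ^ p ^ 2 = 1 := by
  rw [h.commutator_eq] at hg
  obtain ⟨k, rfl⟩ := hg
  simp only
  rw [← zpow_natCast, ← zpow_mul, mul_comm, zpow_mul, zpow_natCast, h.pow_sq_eq_one, one_zpow]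

/-- In the collection formula d ∈ G' has exponent divisible by p², while e and f lie in ⟨c ^ p⟩ and
have exponents divisible by p, so all three corrections vanish. -/
theorem mul_pow_prime_pow [hp : Fact p.Prime] (h : CharData p n m w a b) (h2 : 2 < p)
    {N : ℕ} (hN : 2 ≤ N) (x y : G) :
    (x * y) ^ p ^ N = x ^ p ^ N * y ^ p ^ N := by
  have hd := pcomm_mem_commutator y x
  have he := h.pcomm_mem _ hd x
  have hf := h.pcomm_mem _ hd y
  have hec := h.zpowers_le_center he
  have hfc := h.zpowers_le_center hf
  rw [mul_pow_collect (mul_mul_pcomm y x).symm (mul_mul_pcomm _ x).symm (mul_mul_pcomm _ y).symm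
    (fun g => (Subgroup.mem_center_iff.1 hec g).symm)
    (fun g => (Subgroup.mem_center_iff.1 hfc g).symm)]
  obtain ⟨k, hk⟩ := sq_dvd_choose_two_prime_pow hp.out h2 hN
  obtain ⟨l, hl⟩ := dvd_choose_three_prime_pow hp.out hN
  rw [hk, hl, pow_mul _ (p ^ 2) k, h.pow_sq_eq_one_of_mem hd, pow_mul _ p l,
    h.pow_eq_one_of_mem he,
    show p ^ 2 * k + 2 * (p * l) = p * (p * k + 2 * l) by ring, pow_mul _ p,
    h.pow_eq_one_of_mem hf]
  simp only [one_pow, mul_one]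

theorem normal_form_pow_prime_pow [hp : Fact p.Prime] (h : CharData p n m w a b) (h2 : 2 < p)
    {N : ℕ} (hN : 2 ≤ N) (i j : ℤ) {g : G} (hg : g ∈ commutator G) :
    (a ^ i * b ^ j * g) ^ p ^ N = (a ^ p ^ N) ^ i * (b ^ p ^ N) ^ j := by
  have hg1 : g ^ p ^ N = 1 := by
    obtain ⟨k, rfl⟩ := Nat.exists_eq_add_of_le hN
    rw [pow_add, pow_mul, h.pow_sq_eq_one_of_mem hg, one_pow]
  rw [h.mul_pow_prime_pow h2 hN, h.mul_pow_prime_pow h2 hN, hg1, mul_one]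
  simp only [← zpow_natCast, ← zpow_mul]
  rw [mul_comm i, mul_comm j]

/-- Modulo Z = ⟨c ^ p⟩ all commutators are central, so `pcomm_normal_form` applies there; u is the
error in lifting back. -/
theorem exists_pcomm_normal_form (h : CharData p n m w a b) (i j s t : ℤ) {g g' : G}
    (hg : g ∈ commutator G) (hg' : g' ∈ commutator G) :
    ∃ u ∈ Subgroup.zpowers (pcomm a b ^ p),
      pcomm (a ^ i * b ^ j * g) (a ^ s * b ^ t * g') = pcomm a b ^ (i * t - j * s) * u := by
  set Z := Subgroup.zpowers (pcomm a b ^ p) with hZ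
  have : Z.Normal := ⟨fun x hx y => by
    rw [Subgroup.mem_center_iff.1 (h.zpowers_le_center hx) y, mul_inv_cancel_right]
    exact hx⟩
  have hcen : ∀ x ∈ commutator G, (QuotientGroup.mk' Z x) ∈ Subgroup.center (G ⧸ Z) := by
    intro x hx
    rw [Subgroup.mem_center_iff]
    intro y
    obtain ⟨y, rfl⟩ := QuotientGroup.mk'_surjective Z y
    have h1 : QuotientGroup.mk' Z (pcomm x y) = 1 :=
      (QuotientGroup.eq_one_iff _).2 (h.pcomm_mem x hx y)
    rw [map_pcomm] at h1
    rw [← mul_mul_pcomm (QuotientGroup.mk' Z x), h1, mul_one]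
  have hc : ∀ x y : G ⧸ Z, pcomm x y ∈ Subgroup.center (G ⧸ Z) := by
    intro x y
    obtain ⟨x, rfl⟩ := QuotientGroup.mk'_surjective Z x
    obtain ⟨y, rfl⟩ := QuotientGroup.mk'_surjective Z y
    rw [← map_pcomm]
    exact hcen _ (pcomm_mem_commutator x y)
  have key := pcomm_normal_form hc (a := QuotientGroup.mk' Z a) (b := QuotientGroup.mk' Z b)
    (hcen g hg) (hcen g' hg') i j s t
  simp only [← map_zpow, ← map_mul, ← map_pcomm] at key
  exact ⟨_, QuotientGroup.eq.1 key.symm, (mul_inv_cancel_left _ _).symm⟩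

/-- Commutators with c are central, hence additive in the exponents; u is central and g is a power
of c, so neither contributes. -/
theorem pcomm_eq_zpow (h : CharData p n m w a b) (i j D : ℤ) {g u : G} (hg : g ∈ commutator G)
    (hu : u ∈ Subgroup.zpowers (pcomm a b ^ p)) :
    pcomm (pcomm a b ^ D * u) (a ^ i * b ^ j * g) =
      (pcomm a b ^ p) ^ (D * (i * (w 0 1).val + j * (w 1 1).val)) := by
  have hc := pcomm_mem_commutator a b
  have hcen : ∀ x, pcomm (pcomm a b) x ∈ Subgroup.center G := fun x =>
    h.zpowers_le_center (h.pcomm_mem _ hc x)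
  have hg1 : pcomm (pcomm a b) g = 1 := by
    rw [h.commutator_eq] at hg
    obtain ⟨k, rfl⟩ := hg
    change pcomm (pcomm a b) (pcomm a b ^ k) = 1
    rw [pcomm_zpow_right (hcen _), pcomm_self, one_zpow]
  rw [pcomm_mul_left (h.zpowers_le_center (h.pcomm_mem _ (zpow_mem hc D) _)),
    pcomm_eq_one_of_mem_center_left (h.zpowers_le_center hu), mul_one,
    pcomm_zpow_left (hcen _), pcomm_mul_right (hcen _), hg1, mul_one, pcomm_mul_right (hcen _),
    pcomm_zpow_right (hcen _), pcomm_zpow_right (hcen _), h.pcomm_left, h.pcomm_right]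
  simp only [← zpow_natCast, ← zpow_mul, ← zpow_add]
  congr 1
  push_cast
  ring

theorem pcomm_pow_eq (h : CharData p n m w a b) (D : ℤ) {u : G}
    (hu : u ∈ Subgroup.zpowers (pcomm a b ^ p)) (k : ℕ) :
    (pcomm a b ^ D * u) ^ (k * p) = (pcomm a b ^ p) ^ (D * k) := by
  have hcomm : Commute (pcomm a b ^ D) u :=
    Subgroup.mem_center_iff.1 (h.zpowers_le_center hu) _
  rw [mul_comm k, pow_mul, hcomm.mul_pow, h.pow_eq_one_of_mem hu, mul_one]
  simp only [← zpow_natCast, ← zpow_mul]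
  congr 1
  ring

/-- The relations with matrix `v` for the pair `a ^ i * b ^ j * g`, `a ^ (s * p ^ (n - m)) * b ^ t * g'`
amount to a linear system over `ZMod p`. -/
theorem relations_iff [hp : Fact p.Prime] (h : CharData p n m w a b) (h2 : 2 < p)
    (hm : 2 ≤ m) (hmn : m ≤ n) (v : Matrix (Fin 2) (Fin 2) (ZMod p)) (i j s t D : ℤ) {g g' A B : G}
    (hg : g ∈ commutator G) (hg' : g' ∈ commutator G) (hA : A = a ^ i * b ^ j * g)
    (hB : B = a ^ (s * (p : ℤ) ^ (n - m)) * b ^ t * g')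
    (hD : D = i * t - j * (s * (p : ℤ) ^ (n - m))) :
    (A ^ p ^ n = pcomm A B ^ ((v 0 0).val * p) ∧ B ^ p ^ m = pcomm A B ^ ((v 1 0).val * p) ∧
      pcomm (pcomm A B) A = pcomm A B ^ ((v 0 1).val * p) ∧
      pcomm (pcomm A B) B = pcomm A B ^ ((v 1 1).val * p)) ↔
    ((i * w 0 0 + j * p ^ (n - m) * w 1 0 : ZMod p) = D * v 0 0 ∧
      (s * w 0 0 + t * w 1 0 : ZMod p) = D * v 1 0 ∧
      (D * (i * w 0 1 + j * w 1 1) : ZMod p) = D * v 0 1 ∧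
      (D * (s * p ^ (n - m) * w 0 1 + t * w 1 1) : ZMod p) = D * v 1 1) := by
  obtain ⟨u, hu, hC⟩ := h.exists_pcomm_normal_form i j (s * (p : ℤ) ^ (n - m)) t hg hg'
  rw [← hA, ← hB, ← hD] at hC
  have hpow : p ^ n = p ^ m * p ^ (n - m) := by rw [← pow_add, Nat.add_sub_cancel' hmn]
  have hAn : A ^ p ^ n = (pcomm a b ^ p) ^
      (i * (w 0 0).val + j * (p : ℤ) ^ (n - m) * (w 1 0).val) := by
    rw [hA, h.normal_form_pow_prime_pow h2 (hm.trans hmn) _ _ hg, h.left_pow, hpow, pow_mul b,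
      h.right_pow]
    simp only [← zpow_natCast, ← zpow_mul, ← zpow_add]
    congr 1
    push_cast
    ring
  have hBm : B ^ p ^ m = (pcomm a b ^ p) ^ (s * (w 0 0).val + t * (w 1 0).val) := by
    -- The factor p^(n-m) in the exponent of a is what turns its p^m-th power into a power of
    -- a^(p^n).
    have hz : ∀ x : G, (x ^ p ^ m) ^ (s * (p : ℤ) ^ (n - m)) = (x ^ p ^ n) ^ s := by
      intro x
      rw [hpow]
      simp only [← zpow_natCast, ← zpow_mul]
      congr 1
      push_cast
      ring
    rw [hB, h.normal_form_pow_prime_pow h2 hm _ _ hg', hz, h.left_pow, h.right_pow]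
    simp only [← zpow_natCast, ← zpow_mul, ← zpow_add]
    congr 1
    push_cast
    ring
  have hCA := h.pcomm_eq_zpow i j D hg hu
  have hCB := h.pcomm_eq_zpow (s * (p : ℤ) ^ (n - m)) t D hg' hu
  rw [← hA, ← hC] at hCA
  rw [← hB, ← hC] at hCB
  rw [hAn, hBm, hCA, hCB, hC]
  -- All sides are now powers of c ^ p, of order p, so each relation is an equation of exponents in
  -- `ZMod p`.
  simp only [h.pcomm_pow_eq D hu, zpow_eq_zpow_iff_zmod h.orderOf_pow]
  push_cast
  simp only [ZMod.natCast_zmod_val]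

/-- The map onto ℤ/pⁿ × ℤ/pᵐ has kernel containing G', which has order p². -/
theorem card_le [hp : Fact p.Prime] (h : CharData p n m w a b) [Finite G] :
    p ^ n * p ^ m * p ^ 2 ≤ Nat.card G := by
  obtain ⟨f, hfa, hfb⟩ := h.exists_proj
  have hsurj : f.range = ⊤ := by
    rw [eq_top_iff]
    rintro ⟨x, y⟩ -
    refine ⟨a ^ (x.toAdd.val) * b ^ (y.toAdd.val), ?_⟩
    have h1 : ∀ (k : ℕ) [NeZero k] (x : Multiplicative (ZMod k)),
        Multiplicative.ofAdd (1 : ZMod k) ^ x.toAdd.val = x := by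
      intro k _ x
      rw [← ofAdd_nsmul, nsmul_one, ZMod.natCast_zmod_val, ofAdd_toAdd]
    rw [map_mul, map_pow, map_pow, hfa, hfb]
    simp [h1]
  have hcardZ : Nat.card (Multiplicative (ZMod (p ^ n)) × Multiplicative (ZMod (p ^ m))) =
      p ^ n * p ^ m := by
    rw [Nat.card_prod]
    exact congrArg₂ _ (Nat.card_zmod _) (Nat.card_zmod _)
  have hindex : f.ker.index = p ^ n * p ^ m := by
    rw [Subgroup.index_ker, hsurj, Subgroup.card_top, hcardZ]
  have hker : p ^ 2 ≤ Nat.card f.ker := by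
    rw [← h.orderOf_eq, ← Nat.card_zpowers, ← h.commutator_eq]
    exact Subgroup.card_le_of_le (Abelianization.commutator_subset_ker f)
  rw [← f.ker.card_mul_index, hindex, mul_comm]
  exact Nat.mul_le_mul_right _ hker

end CharData

/-! ### Isomorphism of groups with the same matrix -/

/-- A generating pair satisfying the relations with matrix `v`, in a group that is as large as
these relations allow. -/
structure IsMaximalPair (p n m : ℕ) {G : Type*} [Group G] (v : Matrix (Fin 2) (Fin 2) (ZMod p))
    (a b : G) : Prop where
  closure_eq_top : Subgroup.closure {a, b} = ⊤
  pow_sq : pcomm a b ^ p ^ 2 = 1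
  pow_mem_center : pcomm a b ^ p ∈ Subgroup.center G
  left_pow : a ^ p ^ n = pcomm a b ^ ((v 0 0).val * p)
  right_pow : b ^ p ^ m = pcomm a b ^ ((v 1 0).val * p)
  pcomm_left : pcomm (pcomm a b) a = pcomm a b ^ ((v 0 1).val * p)
  pcomm_right : pcomm (pcomm a b) b = pcomm a b ^ ((v 1 1).val * p)
  finite : Finite G
  card_le : p ^ n * p ^ m * p ^ 2 ≤ Nat.card G

theorem bijective_of_maps_generators {p n m : ℕ} {K G : Type*} [Group K] [Finite K] [Group G]
    {v : Matrix (Fin 2) (Fin 2) (ZMod p)} {a b : G} (h : IsMaximalPair p n m v a b)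
    (f : K →* G) {x y : K} (hx : f x = a) (hy : f y = b)
    (hK : Nat.card K ≤ p ^ n * p ^ m * p ^ 2) : Function.Bijective f := by
  have hsurj : Function.Surjective f := by
    rw [← MonoidHom.range_eq_top, eq_top_iff, ← h.closure_eq_top, Subgroup.closure_le]
    rintro _ (rfl | rfl)
    · exact ⟨x, hx⟩
    · exact ⟨y, hy⟩
  exact hsurj.bijective_of_nat_card_le (hK.trans h.card_le)

/-- Two groups with maximal pairs for the same matrix are isomorphic: both are isomorphic to the
subgroup of the product generated by the two pairs. -/
theorem IsMaximalPair.nonempty_mulEquiv {p n m : ℕ} [hp : Fact p.Prime] {G H : Type*} [Group G]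
    [Group H] {v : Matrix (Fin 2) (Fin 2) (ZMod p)} {a b : G} {a' b' : H}
    (h : IsMaximalPair p n m v a b) (h' : IsMaximalPair p n m v a' b') : Nonempty (G ≃* H) := by
  have := h.finite
  have := h'.finite
  let K : Subgroup (G × H) := Subgroup.closure {(a, a'), (b, b')}
  let x : K := ⟨(a, a'), Subgroup.subset_closure (by simp)⟩
  let y : K := ⟨(b, b'), Subgroup.subset_closure (by simp)⟩
  have hxy : Subgroup.closure {x, y} = ⊤ := by
    rw [← Subgroup.closure_closure_coe_preimage (k := {(a, a'), (b, b')})]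
    congr 1
    ext u
    simp [x, y, Subtype.ext_iff]
  let π₁ : K →* G := (MonoidHom.fst G H).comp K.subtype
  let π₂ : K →* H := (MonoidHom.snd G H).comp K.subtype
  -- Relations in K are checked in the two coordinates, so K inherits those shared by G and H.
  have hext : ∀ u u' : K, π₁ u = π₁ u' → π₂ u = π₂ u' → u = u' := fun u u' h1 h2 =>
    Subtype.ext (Prod.ext h1 h2)
  have hx₁ : π₁ x = a := rfl
  have hx₂ : π₂ x = a' := rfl
  have hy₁ : π₁ y = b := rfl
  have hy₂ : π₂ y = b' := rfl
  have hcen : pcomm x y ^ p ∈ Subgroup.center K := by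
    rw [Subgroup.mem_center_iff]
    intro g
    apply hext
    · simpa only [map_mul, map_pow, map_pcomm, hx₁, hy₁] using
        Subgroup.mem_center_iff.1 h.pow_mem_center (π₁ g)
    · simpa only [map_mul, map_pow, map_pcomm, hx₂, hy₂] using
        Subgroup.mem_center_iff.1 h'.pow_mem_center (π₂ g)
  have hc : pcomm x y ^ p ^ 2 = 1 := by
    apply hext
    · simpa only [map_one, map_pow, map_pcomm, hx₁, hy₁] using h.pow_sq
    · simpa only [map_one, map_pow, map_pcomm, hx₂, hy₂] using h'.pow_sq
  have h1 : x ^ p ^ n = pcomm x y ^ ((v 0 0).val * p) := by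
    apply hext
    · simpa only [map_pow, map_pcomm, hx₁, hy₁] using h.left_pow
    · simpa only [map_pow, map_pcomm, hx₂, hy₂] using h'.left_pow
  have h2 : y ^ p ^ m = pcomm x y ^ ((v 1 0).val * p) := by
    apply hext
    · simpa only [map_pow, map_pcomm, hx₁, hy₁] using h.right_pow
    · simpa only [map_pow, map_pcomm, hx₂, hy₂] using h'.right_pow
  have h3 : pcomm (pcomm x y) x = pcomm x y ^ ((v 0 1).val * p) := by
    apply hext
    · simpa only [map_pow, map_pcomm, hx₁, hy₁] using h.pcomm_left
    · simpa only [map_pow, map_pcomm, hx₂, hy₂] using h'.pcomm_left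
  have h4 : pcomm (pcomm x y) y = pcomm x y ^ ((v 1 1).val * p) := by
    apply hext
    · simpa only [map_pow, map_pcomm, hx₁, hy₁] using h.pcomm_right
    · simpa only [map_pow, map_pcomm, hx₂, hy₂] using h'.pcomm_right
  have hmem : ∀ k : ℕ, pcomm x y ^ (k * p) ∈ Subgroup.center K := fun k => by
    rw [mul_comm, pow_mul]; exact pow_mem hcen k
  have hnormal : (Subgroup.zpowers (pcomm x y)).Normal := by
    refine normal_of_conj_generators hxy ?_
    rintro s (rfl | rfl)
    · rw [h3]; exact ⟨hmem _, pow_mem (Subgroup.mem_zpowers _) _⟩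
    · rw [h4]; exact ⟨hmem _, pow_mem (Subgroup.mem_zpowers _) _⟩
  -- The relations alone bound |K| by the lower bound for |G| and |H|, so both projections are
  -- bijective.
  have hcard : Nat.card K ≤ p ^ n * p ^ m * p ^ 2 := by
    refine (card_le_of_generators hxy (Subgroup.zpowers (pcomm x y)) (Subgroup.mem_zpowers _)
      (pow_pos hp.out.pos n) (pow_pos hp.out.pos m) ?_ ?_).trans (Nat.mul_le_mul_left _ ?_)
    · rw [h1]; exact pow_mem (Subgroup.mem_zpowers _) _
    · rw [h2]; exact pow_mem (Subgroup.mem_zpowers _) _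
    · rw [Nat.card_zpowers]
      exact Nat.le_of_dvd (pow_pos hp.out.pos 2) (orderOf_dvd_of_pow_eq_one hc)
  exact ⟨(MulEquiv.ofBijective π₁ (bijective_of_maps_generators h π₁ hx₁ hy₁ hcard)).symm.trans
    (MulEquiv.ofBijective π₂ (bijective_of_maps_generators h' π₂ hx₂ hy₂ hcard))⟩

/-! ### Changes of generators -/

namespace CharData

variable {p n m : ℕ} {G : Type*} [Group G]
  {w v : Matrix (Fin 2) (Fin 2) (ZMod p)} {a b : G}

theorem isMaximalPair [Fact p.Prime] [hG : Finite G] (h : CharData p n m w a b) :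
    IsMaximalPair p n m w a b :=
  ⟨h.closure_eq_top, h.pow_sq_eq_one, h.pow_mem_center, h.left_pow, h.right_pow, h.pcomm_left,
    h.pcomm_right, hG, h.card_le⟩

/-- The pair `a ^ i * b ^ j`, `a ^ s * b ^ t` generates as soon as its determinant is prime to
`p`. -/
theorem closure_pair_eq_top (h : CharData p n m w a b) (hG : IsPGroup p G) (i j s t : ℤ)
    (hD : IsCoprime (i * t - j * s) (p : ℤ)) :
    Subgroup.closure {a ^ i * b ^ j, a ^ s * b ^ t} = ⊤ := by
  set S := Subgroup.closure {a ^ i * b ^ j, a ^ s * b ^ t} with hS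
  have hA : a ^ i * b ^ j ∈ S := Subgroup.subset_closure (by simp)
  have hB : a ^ s * b ^ t ∈ S := Subgroup.subset_closure (by simp)
  obtain ⟨u, hu, hC⟩ := h.exists_pcomm_normal_form i j s t (one_mem _) (one_mem _)
  rw [mul_one, mul_one] at hC
  have hCS : pcomm (a ^ i * b ^ j) (a ^ s * b ^ t) ∈ S :=
    mul_mem (mul_mem (mul_mem (inv_mem hA) (inv_mem hB)) hA) hB
  rw [hC] at hCS
  have mem_of_zpow : ∀ x : G, x ^ (i * t - j * s) ∈ S → x ∈ S := fun x hx => by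
    obtain ⟨k, hk⟩ := hG x
    exact mem_of_zpow_mem_of_coprime hk hD hx
  -- Raising c^D u ∈ S to the p-th power kills u, leaving (c ^ p)^D. Once c ^ p lies in S, so do u
  -- and then c.
  have hz : pcomm a b ^ p ∈ S := by
    apply mem_of_zpow
    have := h.pcomm_pow_eq (i * t - j * s) hu 1
    rw [one_mul, Nat.cast_one, mul_one] at this
    rw [← this]
    exact pow_mem hCS p
  have huS : u ∈ S := (Subgroup.zpowers_le.2 hz) hu
  have hcS : pcomm a b ∈ S := mem_of_zpow _ ((Subgroup.mul_mem_cancel_right S huS).1 hCS)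
  have hle : commutator G ≤ S := by rwa [h.commutator_eq, Subgroup.zpowers_le]
  have : S.Normal := ⟨fun x hx y => by
    have := mul_mem (hle (pcomm_mem_commutator y⁻¹ x⁻¹)) hx
    rwa [pcomm, inv_inv, inv_inv, inv_mul_cancel_right] at this⟩
  have hcomm : Commute (QuotientGroup.mk' S a) (QuotientGroup.mk' S b) := by
    have h1 : QuotientGroup.mk' S (pcomm a b) = 1 := (QuotientGroup.eq_one_iff _).2 hcS
    have h2 := congrArg (QuotientGroup.mk' S) (mul_mul_pcomm a b)
    rw [map_mul, h1, mul_one, map_mul, map_mul] at h2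
    exact h2.symm
  have hA1 : QuotientGroup.mk' S a ^ i * QuotientGroup.mk' S b ^ j = 1 := by
    rw [← map_zpow, ← map_zpow, ← map_mul]; exact (QuotientGroup.eq_one_iff _).2 hA
  have hB1 : QuotientGroup.mk' S a ^ s * QuotientGroup.mk' S b ^ t = 1 := by
    rw [← map_zpow, ← map_zpow, ← map_mul]; exact (QuotientGroup.eq_one_iff _).2 hB
  have hAe := eq_inv_of_mul_eq_one_left hA1
  have hBe := eq_inv_of_mul_eq_one_left hB1
  -- Cramer's rule in the quotient by S: eliminating b from the two relations makes a^D trivial.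
  have ha : a ∈ S := by
    apply mem_of_zpow
    rw [← QuotientGroup.eq_one_iff]
    change QuotientGroup.mk' S (a ^ (i * t - j * s)) = 1
    rw [map_zpow, sub_eq_add_neg, zpow_add, zpow_mul, hAe, mul_comm j s, ← mul_neg, zpow_mul, hBe]
    group
  have hb : b ∈ S := by
    apply mem_of_zpow
    rw [← QuotientGroup.eq_one_iff]
    change QuotientGroup.mk' S (b ^ (i * t - j * s)) = 1
    have hAe' := eq_inv_of_mul_eq_one_right hA1
    have hBe' := eq_inv_of_mul_eq_one_right hB1
    rw [map_zpow, sub_eq_add_neg, zpow_add, mul_comm i t, zpow_mul, hBe', ← mul_neg, zpow_mul, hAe']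
    group
  rw [eq_top_iff, ← h.closure_eq_top, Subgroup.closure_le]
  rintro _ (rfl | rfl)
  · exact ha
  · exact hb

/-- Any two characteristic pairs of a group are related by an integral change of generators. -/
theorem exists_change_of_generators [hp : Fact p.Prime] (hmn : m ≤ n) (h : CharData p n m w a b)
    {a' b' : G} (h' : CharData p n m v a' b') : ∃ i j s t : ℤ, ∃ g ∈ commutator G,
      ∃ g' ∈ commutator G, a' = a ^ i * b ^ j * g ∧ b' = a ^ (s * (p : ℤ) ^ (n - m)) * b ^ t * g' ∧
      ((i * t - j * (s * (p : ℤ) ^ (n - m)) : ℤ) : ZMod p) ≠ 0 := by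
  obtain ⟨i, j, g, hg, ha'⟩ := exists_normal_form h.closure_eq_top (commutator G)
    (pcomm_mem_commutator a b) a'
  obtain ⟨s₀, t, g', hg', hb'⟩ := exists_normal_form h.closure_eq_top (commutator G)
    (pcomm_mem_commutator a b) b'
  -- Since b'^(p^m) lies in G', its image p^m s₀ in ℤ/pⁿ is zero.
  have hdvd : (p : ℤ) ^ (n - m) ∣ s₀ := by
    obtain ⟨f, hfa, hfb⟩ := h.exists_proj
    have hker : ∀ x ∈ commutator G, f x = 1 := fun x hx => Abelianization.commutator_subset_ker f hx
    have h1 : f (b' ^ p ^ m) = 1 := by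
      rw [h'.right_pow]; exact hker _ (pow_mem (pcomm_mem_commutator _ _) _)
    rw [map_pow, hb', map_mul, hker g' hg', mul_one, map_mul, map_zpow, map_zpow, hfa, hfb] at h1
    have h2 := congrArg (fun x => x.1.toAdd) h1
    simp only [Prod.pow_fst, Prod.fst_mul, one_zpow, mul_one, Prod.fst_one, toAdd_pow, toAdd_zpow,
      toAdd_ofAdd, toAdd_one, zsmul_one, nsmul_eq_mul] at h2
    rw [← Int.cast_natCast (R := ZMod (p ^ n)), ← Int.cast_mul,
      ZMod.intCast_zmod_eq_zero_iff_dvd] at h2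
    have hpow : ((p ^ n : ℕ) : ℤ) = ((p ^ m : ℕ) : ℤ) * (p : ℤ) ^ (n - m) := by
      push_cast
      rw [← pow_add, Nat.add_sub_cancel' hmn]
    rw [hpow] at h2
    exact Int.dvd_of_mul_dvd_mul_left (by exact_mod_cast (pow_pos hp.out.pos m).ne') h2
  obtain ⟨s, rfl⟩ := hdvd
  rw [mul_comm _ s] at hb'
  refine ⟨i, j, s, t, g, hg, g', hg', ha', hb', fun hD => ?_⟩
  -- If p divided D, the p-th power of [a', b'] would be (c ^ p)^D = 1, but [a', b'] has order p².
  obtain ⟨u, hu, hC⟩ := h.exists_pcomm_normal_form i j (s * (p : ℤ) ^ (n - m)) t hg hg'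
  rw [← ha', ← hb'] at hC
  have hpow := h.pcomm_pow_eq (i * t - j * (s * (p : ℤ) ^ (n - m))) hu 1
  rw [← hC, one_mul, Nat.cast_one, mul_one] at hpow
  have h1 : (pcomm a b ^ p) ^ (i * t - j * (s * (p : ℤ) ^ (n - m))) = 1 := by
    rw [← zpow_zero (pcomm a b ^ p), zpow_eq_zpow_iff_zmod h.orderOf_pow, hD, Int.cast_zero]
  have h2 := h'.orderOf_pow
  rw [hpow, h1, orderOf_one] at h2
  exact hp.out.one_lt.ne h2

/-- Characteristic data transport along isomorphisms. -/
theorem map {H : Type*} [Group H] (h : CharData p n m w a b) (e : G ≃* H) :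
    CharData p n m w (e a) (e b) := by
  have hc : pcomm (e a) (e b) = e (pcomm a b) := (map_pcomm e.toMonoidHom a b).symm
  have hcx : ∀ x y, pcomm (e x) (e y) = e (pcomm x y) := fun x y =>
    (map_pcomm e.toMonoidHom x y).symm
  have hcommutator : commutator H = (commutator G).map e.toMonoidHom := by
    rw [commutator_def, commutator_def, Subgroup.map_commutator,
      Subgroup.map_top_of_surjective _ e.surjective]
  have hz : ∀ x : G, (Subgroup.zpowers x).map e.toMonoidHom = Subgroup.zpowers (e x) := fun x =>
    MonoidHom.map_zpowers _ _
  refine ⟨?_, ?_, ?_, ?_, ?_, ?_, ?_, ?_, ?_, ?_⟩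
  · have := MonoidHom.map_closure e.toMonoidHom {a, b}
    rw [h.closure_eq_top, Subgroup.map_top_of_surjective _ e.surjective, Set.image_pair] at this
    exact this.symm
  · rw [hc, MulEquiv.orderOf_eq, h.orderOf_eq]
  · rw [hc, hcommutator, h.commutator_eq, hz]
  · rw [hc, ← map_pow, Subgroup.mem_center_iff]
    intro g
    obtain ⟨g, rfl⟩ := e.surjective g
    rw [← map_mul, ← map_mul, Subgroup.mem_center_iff.1 h.pow_mem_center]
  · rw [hcommutator]
    rintro _ ⟨g, hg, rfl⟩ x
    obtain ⟨x, rfl⟩ := e.surjective x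
    rw [hc, ← map_pow, ← hz]
    exact ⟨_, h.pcomm_mem g hg x, (hcx g x).symm⟩
  · obtain ⟨f, hfa, hfb⟩ := h.exists_proj
    exact ⟨f.comp e.symm.toMonoidHom, by simp [hfa], by simp [hfb]⟩
  · rw [hc, ← map_pow, ← map_pow, h.left_pow]
  · rw [hc, ← map_pow, ← map_pow, h.right_pow]
  · rw [hc, hcx, ← map_pow, h.pcomm_left]
  · rw [hc, hcx, ← map_pow, h.pcomm_right]

end CharData

/-! ### The isomorphism criterion -/

theorem theorem3p3 (p : ℕ) [Fact p.Prime] (hp : 2 < p) (n m : ℕ) (hm : 2 ≤ m) (hmn : m ≤ n)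
    {G : Type*} [Group G] {H : Type*} [Group H]
    (hG : InClass p n m G) (hH : InClass p n m H)
    (w v : Matrix (Fin 2) (Fin 2) (ZMod p))
    (hw : IsCharMatrix p n m G w) (hv : IsCharMatrix p n m H v) :
    Nonempty (G ≃* H) ↔
      ∃ x₁₁ x₁₂ x₂₁ x₂₂ : ZMod p, ∃ X : Matrix (Fin 2) (Fin 2) (ZMod p),
        X = !![x₁₁, x₁₂; x₂₁ * (p : ZMod p) ^ (n - m), x₂₂] ∧
        IsUnit X ∧
        v.col 0 =
          X.det⁻¹ • (!![x₁₁, x₁₂ * (p : ZMod p) ^ (n - m); x₂₁, x₂₂]).mulVec (w.col 0) ∧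
        v.col 1 = X.mulVec (w.col 1) := by
  obtain ⟨a, b, hab, h1, h2, h3, h4⟩ := hw
  have hw := hG.charData hab h1 h2 h3 h4
  obtain ⟨a', b', hab', h1', h2', h3', h4'⟩ := hv
  have hv := hH.charData hab' h1' h2' h3' h4'
  have := hG.finite
  have := hH.finite
  constructor
  · rintro ⟨e⟩
    -- The pair of H is pulled back to G, so that two characteristic pairs of one group are
    -- compared.
    have hv' := hv.map e.symm
    obtain ⟨i, j, s, t, g, hg, g', hg', hA, hB, hD⟩ := hw.exists_change_of_generators hmn hv'
    obtain ⟨e1, e2, e3, e4⟩ := (hw.relations_iff hp hm hmn v i j s t _ hg hg' hA hB rfl).1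
      ⟨hv'.left_pow, hv'.right_pow, hv'.pcomm_left, hv'.pcomm_right⟩
    have hdet : (!![(i : ZMod p), (j : ZMod p); (s : ZMod p) * (p : ZMod p) ^ (n - m),
        (t : ZMod p)]).det = ((i * t - j * (s * (p : ℤ) ^ (n - m)) : ℤ) : ZMod p) := by
      rw [Matrix.det_fin_two_of]; push_cast; ring
    refine ⟨i, j, s, t, _, rfl, ?_, ?_, ?_⟩
    · rw [Matrix.isUnit_iff_isUnit_det, hdet]
      exact hD.isUnit
    · rw [hdet]
      ext k
      fin_cases k
      · simp only [Fin.zero_eta, Matrix.col_apply, Pi.smul_apply, smul_eq_mul, Matrix.mulVec,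
          dotProduct, Fin.sum_univ_two, Matrix.of_apply, Matrix.cons_val_zero, Matrix.cons_val_one]
        rw [e1, inv_mul_cancel_left₀ hD]
      · simp only [Fin.mk_one, Matrix.col_apply, Pi.smul_apply, smul_eq_mul, Matrix.mulVec,
          dotProduct, Fin.sum_univ_two, Matrix.of_apply, Matrix.cons_val_zero, Matrix.cons_val_one]
        rw [e2, inv_mul_cancel_left₀ hD]
    · ext k
      fin_cases k
      · simpa [Matrix.mulVec, dotProduct, Fin.sum_univ_two] using (mul_left_cancel₀ hD e3).symm
      · simpa [Matrix.mulVec, dotProduct, Fin.sum_univ_two] using (mul_left_cancel₀ hD e4).symm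
  · rintro ⟨x₁₁, x₁₂, x₂₁, x₂₂, X, hX, hunit, hc0, hc1⟩
    -- Any integer lifts of the entries serve as exponents of a new pair in G, with g = g' = 1.
    obtain ⟨i, hi'⟩ := ZMod.intCast_surjective x₁₁
    obtain ⟨j, hj'⟩ := ZMod.intCast_surjective x₁₂
    obtain ⟨s, hs'⟩ := ZMod.intCast_surjective x₂₁
    obtain ⟨t, ht'⟩ := ZMod.intCast_surjective x₂₂
    have hdet : X.det = ((i * t - j * (s * (p : ℤ) ^ (n - m)) : ℤ) : ZMod p) := by
      rw [hX, Matrix.det_fin_two_of]; push_cast; rw [hi', hj', hs', ht']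
    have hD : ((i * t - j * (s * (p : ℤ) ^ (n - m)) : ℤ) : ZMod p) ≠ 0 := by
      rw [← hdet]; exact ((Matrix.isUnit_iff_isUnit_det X).1 hunit).ne_zero
    have hcop : IsCoprime (i * t - j * (s * (p : ℤ) ^ (n - m))) (p : ℤ) := by
      refine ((Nat.prime_iff_prime_int.1 (Fact.out : p.Prime)).coprime_iff_not_dvd.2 ?_).symm
      rwa [← ZMod.intCast_zmod_eq_zero_iff_dvd]
    have c00 := congrFun hc0 0
    have c01 := congrFun hc0 1
    have c10 := congrFun hc1 0
    have c11 := congrFun hc1 1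
    rw [hdet] at c00 c01
    simp only [hX, Matrix.col_apply, Pi.smul_apply, smul_eq_mul, Matrix.mulVec,
      dotProduct, Fin.sum_univ_two, Matrix.of_apply, Matrix.cons_val_zero, Matrix.cons_val_one]
      at c00 c01 c10 c11
    have hrel := (hw.relations_iff hp hm hmn v i j s t _ (one_mem _) (one_mem _) rfl rfl rfl).2
      ⟨by rw [c00, mul_inv_cancel_left₀ hD, hi', hj'],
       by rw [c01, mul_inv_cancel_left₀ hD, hs', ht'],
       by rw [c10, hi', hj'], by rw [c11, hs', ht']⟩
    rw [mul_one, mul_one] at hrel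
    obtain ⟨u, hu, hC⟩ := hw.exists_pcomm_normal_form i j (s * (p : ℤ) ^ (n - m)) t (one_mem _)
      (one_mem _)
    rw [mul_one, mul_one] at hC
    -- The new pair lives in G itself, so the order bound comes from the old pair.
    have hmax : IsMaximalPair p n m v (a ^ i * b ^ j) (a ^ (s * (p : ℤ) ^ (n - m)) * b ^ t) := by
      refine ⟨hw.closure_pair_eq_top hG.isPGroup _ _ _ _ hcop,
        hw.pow_sq_eq_one_of_mem (pcomm_mem_commutator _ _), ?_, hrel.1, hrel.2.1, hrel.2.2.1,
        hrel.2.2.2, inferInstance, hw.card_le⟩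
      have := hw.pcomm_pow_eq (i * t - j * (s * (p : ℤ) ^ (n - m))) hu 1
      rw [← hC, one_mul] at this
      rw [this]
      exact zpow_mem hw.pow_mem_center _
    exact hmax.nonempty_mulEquiv hv.isMaximalPair
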